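/- **Theorem (Efficient Self-stabilizing Coloring Algorithm).** Consider the synchronous message-passing (CONGEST) model on an $n$-vertex graph $G=(V,E)$ of maximum degree $\Delta$. Each vertex $v$ has a unique identifier $id(v)\in\{0,\dots,n-1\}$ and distinguishes its incident links by ports numbered $0,\dots,\deg(v)-1$ in an arbitrary way. The memory of a vertex consists of a faultless read-only part (ROM), which holds $id(v)$, $n$, $\Delta$, $\deg(v)$ and the program, and of a RAM with finitely many possible contents. In every round each vertex sends a message (a bit string) through each of its ports, receives the messages of its neighbors, and computes the new content of its RAM from its ROM, its RAM and the messages received; its current color is a function of its ROM and RAM. An adversary may, at any moment, change the RAM of all vertices arbitrarily. There are a deterministic algorithm $\mathcal A$ in this model and absolute constants $C_1,C_2$ such that for every such graph, with any assignment of identifiers and any port numbering, the following holds. 1. There is an integer $T\le C_1\,\Delta^{3/4}\log_2\Delta+\log^* n$ (where $\Delta^{3/4}\log_2\Delta$ is read as $0$ if $\Delta=0$) such that in every execution of $\mathcal A$ and for every $T_0\ge 0$: if the adversary makes no change after round $T_0$, then at the end of every round $t\ge T_0+T$ the colors of the vertices form a proper coloring of $G$ with colors from $\{0,1,\dots,\Delta\}$.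 2. Every message sent through a port, whatever the contents of the RAMs, has at most $C_2\log_2 n$ bits. Here $\log^* n$ is the least number of iterations of $\log_2$, starting from $n$, that gives a value at most $1$. -/

import Mathlib

/-- The iterated logarithm to base two: the least number `k` of applications of `log₂` after which
the value is at most one. -/
noncomputable def logStar (x : ℝ) : ℕ :=
  sInf {k : ℕ | (Real.logb 2)^[k] x ≤ 1}

/-- A communication network on the vertex set `V`: an undirected graph, distinct identifiers from
`{0, …, n - 1}` with `n = |V|`, and for every vertex an arbitrary numbering of its incident links by
ports `0, …, deg v - 1`, the port `p` of `v` leading to the neighbor `port v p`. -/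
structure Network (V : Type*) [Fintype V] where
  graph : SimpleGraph V
  ident : V ↪ Fin (Fintype.card V)
  port : ∀ v : V, Fin (graph.neighborSet v).ncard ≃ graph.neighborSet v

/-- The read-only data of a vertex: the number of vertices, the maximum degree of the network, the
identifier of the vertex, and the number of its ports. -/
structure Rom where
  numVertices : ℕ
  maxDegree : ℕ
  ident : ℕ
  ports : ℕ

/-- A deterministic synchronous message-passing algorithm. All vertices run the same rules, which
depend on nothing but the read-only data of the vertex, the content of its RAM and the messages that
it receives, in particular not on the round number. `color` reads the output off the memory. -/
structure Algorithm where
  /-- The possible contents of the RAM. -/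
  Ram : Rom → Type
  finite_ram : ∀ r, Finite (Ram r)
  /-- The RAM at the start of an execution. -/
  init : ∀ r, Ram r
  /-- The bit string sent through a port. -/
  send : ∀ r, Ram r → Fin r.ports → List Bool
  /-- The new content of the RAM, from the old one and the bit strings received through the
  ports. -/
  update : ∀ r, Ram r → (Fin r.ports → List Bool) → Ram r
  /-- The current color. -/
  color : ∀ r, Ram r → ℕ

namespace Network

variable {V : Type*} [Fintype V] (N : Network V)

open Classical in
/-- The maximum degree of the network. -/
noncomputable def maxDegree : ℕ := N.graph.maxDegree

/-- The read-only data of the vertex `v`. -/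
noncomputable def rom (v : V) : Rom where
  numVertices := Fintype.card V
  maxDegree := N.maxDegree
  ident := N.ident v
  ports := (N.graph.neighborSet v).ncard

/-- The neighbor of `v` at the other end of the link at port `p`. -/
noncomputable def neighbor (v : V) (p : Fin (N.rom v).ports) : V := (N.port v p).1

/-- The port that the link at port `p` of `v` has at its other end. -/
noncomputable def backPort (v : V) (p : Fin (N.rom v).ports) : Fin (N.rom (N.neighbor v p)).ports :=
  (N.port (N.neighbor v p)).symm ⟨v, (N.port v p).2.symm⟩

end Network

namespace Algorithm

variable (A : Algorithm) {V : Type*} [Fintype V] (N : Network V)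

/-- A configuration: the contents of the RAM of all vertices. -/
abbrev Config : Type _ := ∀ v : V, A.Ram (N.rom v)

/-- One undisturbed synchronous round: every vertex sends a message through each of its ports,
receives the messages of its neighbors, and updates its RAM. -/
noncomputable def step (c : A.Config N) : A.Config N := fun v =>
  A.update (N.rom v) (c v) fun p =>
    A.send (N.rom (N.neighbor v p)) (c (N.neighbor v p)) (N.backPort v p)

/-- `σ t` is the configuration at the end of round `t` (`σ 0` at the start) in an execution in which
the adversary interferes in the rounds in `F` only (`0 ∈ F`: already before round `1`). As it may
overwrite all RAM at any moment, the outcome of a round in `F` is arbitrary. -/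
def IsExecution (F : Set ℕ) (σ : ℕ → A.Config N) : Prop :=
  (0 ∉ F → σ 0 = fun v => A.init (N.rom v)) ∧
    ∀ t : ℕ, t + 1 ∉ F → σ (t + 1) = A.step N (σ t)

/-- The configuration `c` shows a proper coloring with colors from `{0, …, q - 1}`. -/
def IsProperColoring (q : ℕ) (c : A.Config N) : Prop :=
  (∀ v, A.color (N.rom v) (c v) < q) ∧
    ∀ u v, N.graph.Adj u v → A.color (N.rom u) (c u) ≠ A.color (N.rom v) (c v)

/-- On the network `N` the algorithm is a self-stabilizing `(Δ+1)`-coloring algorithm with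
stabilization time at most `T`: if the adversary does not interfere after round `T₀`, then at the
end of round `T₀ + T`, and of every later round, the colors are a proper `(Δ+1)`-coloring. -/
def StabilizesWithin (T : ℕ) : Prop :=
  ∀ (F : Set ℕ) (σ : ℕ → A.Config N), A.IsExecution N F σ →
    ∀ T₀ : ℕ, (∀ t ∈ F, t ≤ T₀) →
      ∀ t : ℕ, T₀ + T ≤ t → A.IsProperColoring N (N.maxDegree + 1) (σ t)

/-- Every message that is sent on the network `N`, from whatever memory content, has at most `B`
bits. -/
def MessageBitsAtMost (B : ℝ) : Prop :=
  ∀ (c : A.Config N) (v : V) (p : Fin (N.rom v).ports),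
    ((A.send (N.rom v) (c v) p).length : ℝ) ≤ B

end Algorithm

/-!
Every vertex broadcasts its identifier and its whole memory in each round, and recomputes its
memory from what it receives. The memory is a tuple of fields with levels (which may depend on the
values of fields of lower levels), and the new value of a field depends only on fields of lower
levels of the vertex and its neighbors. So, whatever the memories are when the adversary stops,
the fields become final in the order of their levels, and after as many rounds as there are levels
the configuration is a fixed point (`iterate_fixed_of_levels`). It remains to design fields of
`O(log n)` bits in total, with few levels, such that every fixed point shows a proper
`(Δ+1)`-coloring.

* The first fields are the successive colorings of Linial's color reduction, where a color is read
  as a polynomial without constant term and of degree at most `d` over a prime field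
  (`digitPoly`), so that two colors have at most `d` common points (`card_digitPoly_agree_le`).
  After at most `log* n` steps the colors have `O(log Δ)` bits (`depth_le_logStar`). The bit
  lengths at least halve in every step, so all these colorings together take `O(log n)` bits
  (`sum_bitLen_le`).

* A stage with parameter `β` extends a proper partial coloring. At time `x` a vertex tries to
  adopt the value at `x` of its polynomial over `ℤ/q` as its class, and does so if at most `β` of
  its uncolored neighbors have adopted this value before or try it now. Counting common points
  gives such a time when `q` is of order `D / (β + 1)`, where `D` bounds the uncolored degree
  (`conflicts_adoptTime_le`). The adoption time encodes the whole history of the process, which is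
  why no clock is needed. Then the classes are treated in increasing order. A vertex that sees a
  palette of more than `q₀ * d * β` available colors, where `q₀` is about `√Δ` and colors are
  points of the plane over `ℤ/q₀`, chooses a shift of the graph of its polynomial that contains
  more than `d * β` of them. By the choice of the class, at most `d * β` of these are on the
  curves of neighbors in the same class that did not adopt it later, so a free one remains
  (`stage_shift_eq_none`). A vertex with a smaller palette stays uncolored, but then fewer than
  `q₀ * d * β` of its neighbors are uncolored (`stage_free_lt`). The stage has `3 * q` levels
  (`stage_stabilizes`).

* Two stages suffice. The first, with `β` about `Δ ^ (1/4)`, has `O(Δ ^ (3/4))` classes and leaves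
  an uncolored graph of maximum degree `O(Δ ^ (3/4))`. The second, with `β = 0`, has
  `O(Δ ^ (3/4))` classes and leaves nothing uncolored.

For `Δ ≤ 1` the time bound leaves no room for this, and the vertices compare identifiers instead.
-/

open Finset

/-! ### Digit polynomials -/

/-- The value at `x` of the polynomial over `ℤ/q` without constant term whose coefficients are the
`d` lowest base-`q` digits of `c`. -/
noncomputable def digitPoly (q d c x : ℕ) : ZMod q :=
  ∑ i ∈ range d, ((c / q ^ i % q : ℕ) : ZMod q) * (x : ZMod q) ^ (i + 1)

theorem eq_of_digits_eq {q d : ℕ} :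
    ∀ {c c' : ℕ}, c < q ^ d → c' < q ^ d →
      (∀ i < d, c / q ^ i % q = c' / q ^ i % q) → c = c' := by
  induction d with
  | zero => intro c c' h h' _; simp at h h'; omega
  | succ d ih =>
    intro c c' h h' hdig
    have h0 : c % q = c' % q := by simpa using hdig 0 (by omega)
    have h1 : c / q = c' / q := by
      refine ih (Nat.div_lt_of_lt_mul (by rwa [pow_succ'] at h))
        (Nat.div_lt_of_lt_mul (by rwa [pow_succ'] at h')) fun i hi => ?_
      simpa [Nat.div_div_eq_div_mul, ← pow_succ'] using hdig (i + 1) (by omega)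
    rw [← Nat.div_add_mod c q, ← Nat.div_add_mod c' q, h0, h1]

/-- Two different digit polynomials differ by a given constant in at most `d` points: their
difference has a nonzero coefficient of positive degree. -/
theorem card_digitPoly_agree_le {q d c c' : ℕ} (hq : q.Prime) (hc : c < q ^ d) (hc' : c' < q ^ d)
    (hne : c ≠ c') (a : ZMod q) :
    #{x ∈ range q | digitPoly q d c x = digitPoly q d c' x + a} ≤ d := by
  have : Fact q.Prime := ⟨hq⟩
  let P : Polynomial (ZMod q) :=
    (∑ i ∈ range d, Polynomial.C (((c / q ^ i % q : ℕ) : ZMod q) - ((c' / q ^ i % q : ℕ) : ZMod q))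
      * Polynomial.X ^ (i + 1)) - Polynomial.C a
  have hcoeff : ∀ i < d, P.coeff (i + 1) =
      ((c / q ^ i % q : ℕ) : ZMod q) - ((c' / q ^ i % q : ℕ) : ZMod q) := by
    intro i hi
    simp only [P, Polynomial.coeff_sub, Polynomial.finsetSum_coeff, Polynomial.coeff_C_mul,
      Polynomial.coeff_X_pow, Polynomial.coeff_C_succ, sub_zero, Nat.add_right_cancel_iff]
    simp [hi]
  have hP : P ≠ 0 := by
    intro h0
    refine hne (eq_of_digits_eq hc hc' fun i hi => ?_)
    have := hcoeff i hi
    rw [h0, Polynomial.coeff_zero, eq_comm, sub_eq_zero, ZMod.natCast_eq_natCast_iff'] at this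
    simpa using this
  have hdeg : P.natDegree ≤ d := by
    refine (Polynomial.natDegree_sub_le _ _).trans (max_le ?_ (by simp))
    refine Polynomial.natDegree_sum_le_of_forall_le _ _ fun i hi => ?_
    refine (Polynomial.natDegree_C_mul_X_pow_le _ _).trans ?_
    have := mem_range.1 hi; omega
  have heval : ∀ x : ℕ, P.eval (x : ZMod q) = digitPoly q d c x - digitPoly q d c' x - a := by
    intro x
    simp only [P, digitPoly, Polynomial.eval_sub, Polynomial.eval_finsetSum, Polynomial.eval_mul,
      Polynomial.eval_C, Polynomial.eval_pow, Polynomial.eval_X, sub_mul, sum_sub_distrib]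
  have hinj : Set.InjOn (fun x : ℕ => (x : ZMod q))
      ({x ∈ range q | digitPoly q d c x = digitPoly q d c' x + a} : Finset ℕ) := by
    intro x hx y hy hxy
    simp only [coe_filter, mem_range, Set.mem_ofPred_eq] at hx hy
    have := (ZMod.natCast_eq_natCast_iff' _ _ _).1 hxy
    rwa [Nat.mod_eq_of_lt hx.1, Nat.mod_eq_of_lt hy.1] at this
  rw [← card_image_of_injOn hinj]
  refine le_trans (Polynomial.card_le_degree_of_subset_roots ?_) hdeg
  intro y hy
  rw [mem_val, mem_image] at hy
  obtain ⟨x, hx, rfl⟩ := hy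
  rw [Polynomial.mem_roots hP, Polynomial.IsRoot.def, heval, (mem_filter.1 hx).2]
  ring

@[simp] theorem digitPoly_zero (q d x : ℕ) : digitPoly q d 0 x = 0 := by
  simp [digitPoly]

/-! ### Adoption times -/

section Adoption

variable {ι : Type*} [Fintype ι]

open Classical in
/-- The number of competitors `p` that stand in the way of a vertex of color `a` adopting the class
`digitPoly q d a x` at time `x`: those in `P` whose color is `A p` and whose adoption time is `X p`,
and which adopted this class earlier or try it at time `x` as well. -/
noncomputable def conflicts (q d a : ℕ) (P : ι → Prop) (A X : ι → ℕ) (x : ℕ) : ℕ :=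
  #{p | P p ∧ digitPoly q d (A p) (min (X p) x) = digitPoly q d a x}

/-- The first time below `q` with at most `β` conflicts, or `q - 1` if there is none. -/
noncomputable def adoptTime (q d β a : ℕ) (P : ι → Prop) (A X : ι → ℕ) : ℕ :=
  sInf {x | conflicts q d a P A X x ≤ β ∨ q ≤ x + 1}

theorem adoptTime_lt {q : ℕ} (hq : 0 < q) (d β a : ℕ) (P : ι → Prop) (A X : ι → ℕ) :
    adoptTime q d β a P A X < q := by
  have : adoptTime q d β a P A X ≤ q - 1 := Nat.sInf_le (Or.inr (by omega))
  omega

/-- Every competitor is in conflict at no more than `2 * d` times, `d` with its adopted class and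
`d` with its trials, so some time has few conflicts. -/
theorem conflicts_adoptTime_le {q d β a D : ℕ} {P : ι → Prop} {A X : ι → ℕ} (hq : q.Prime)
    (ha : a ≠ 0) (haq : a < q ^ d) (hA : ∀ p, P p → A p < q ^ d ∧ A p ≠ a)
    (hP : ∀ s : Finset ι, (∀ p ∈ s, P p) → #s ≤ D) (hD : 2 * d * D < q * (β + 1)) :
    conflicts q d a P A X (adoptTime q d β a P A X) ≤ β := by
  classical
  have hex : ∃ x < q, conflicts q d a P A X x ≤ β := by
    by_contra! hcon
    have h1 : q * (β + 1) ≤ ∑ x ∈ range q, conflicts q d a P A X x := by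
      calc q * (β + 1) = ∑ _x ∈ range q, (β + 1) := by simp
        _ ≤ _ := sum_le_sum fun x hx => hcon x (mem_range.1 hx)
    have h2 : ∑ x ∈ range q, conflicts q d a P A X x
        = ∑ p with P p, #{x ∈ range q | digitPoly q d (A p) (min (X p) x) = digitPoly q d a x} := by
      simp only [conflicts, card_filter, sum_filter]
      rw [sum_comm]
      refine sum_congr rfl fun p _ => ?_
      by_cases hp : P p <;> simp [hp]
    have h3 : ∀ p ∈ ({p | P p} : Finset ι),
        #{x ∈ range q | digitPoly q d (A p) (min (X p) x) = digitPoly q d a x} ≤ 2 * d := by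
      intro p hp
      have hp : P p := by simpa using hp
      have hsub : ({x ∈ range q | digitPoly q d (A p) (min (X p) x) = digitPoly q d a x})
          ⊆ {x ∈ range q | digitPoly q d a x = digitPoly q d 0 x + digitPoly q d (A p) (X p)} ∪
            {x ∈ range q | digitPoly q d (A p) x = digitPoly q d a x + 0} := by
        intro x hx
        simp only [mem_filter, mem_union, digitPoly_zero, zero_add, add_zero] at hx ⊢
        rcases le_total (X p) x with h | h
        · left; refine ⟨hx.1, ?_⟩; rw [← hx.2, min_eq_left h]
        · right; refine ⟨hx.1, ?_⟩; rw [← hx.2, min_eq_right h]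
      refine (card_le_card hsub).trans ((card_union_le _ _).trans ?_)
      have e1 := card_digitPoly_agree_le hq haq (pow_pos hq.pos d) ha (digitPoly q d (A p) (X p))
      have e2 := card_digitPoly_agree_le hq (hA p hp).1 haq (hA p hp).2 0
      omega
    have h4 := sum_le_card_nsmul _ _ _ h3
    have h5 : #({p | P p} : Finset ι) ≤ D := hP _ (by simp)
    have h6 : #({p | P p} : Finset ι) • (2 * d) ≤ 2 * d * D := by
      rw [smul_eq_mul, mul_comm]; exact Nat.mul_le_mul_left _ h5
    omega
  obtain ⟨x, hxq, hx⟩ := hex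
  have hmem : adoptTime q d β a P A X ∈ {x | conflicts q d a P A X x ≤ β ∨ q ≤ x + 1} :=
    Nat.sInf_mem ⟨x, Or.inl hx⟩
  have hle : adoptTime q d β a P A X ≤ x := Nat.sInf_le (Or.inl hx)
  rcases hmem with h | h
  · exact h
  · rwa [show adoptTime q d β a P A X = x by omega]

/-- Whether a time below `t + 1` is adopted depends on the adoption times of the competitors
only as far as these are below `t`. -/
theorem min_adoptTime_congr {q d β a t : ℕ} {P : ι → Prop} {A X X' : ι → ℕ}
    (h : ∀ p, min (X p) t = min (X' p) t) :
    min (adoptTime q d β a P A X) (t + 1) = min (adoptTime q d β a P A X') (t + 1) := by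
  have hc : ∀ x ≤ t, conflicts q d a P A X x = conflicts q d a P A X' x := by
    intro x hx
    have : ∀ p, min (X p) x = min (X' p) x := fun p => by have := h p; omega
    unfold conflicts
    congr 1
    ext p
    simp only [mem_filter, this]
  have key : ∀ {X X' : ι → ℕ}, (∀ x ≤ t, conflicts q d a P A X x = conflicts q d a P A X' x) →
      min (adoptTime q d β a P A X') (t + 1) ≤ adoptTime q d β a P A X := by
    intro X X' hc
    by_cases hlt : adoptTime q d β a P A X ≤ t
    · refine (min_le_left _ _).trans (Nat.sInf_le ?_)
      have hmem : adoptTime q d β a P A X ∈ {x | conflicts q d a P A X x ≤ β ∨ q ≤ x + 1} :=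
        Nat.sInf_mem ⟨q, Or.inr (by omega)⟩
      simpa only [Set.mem_ofPred_eq, hc _ hlt] using hmem
    · exact (min_le_right _ _).trans (by omega)
  have h1 := key hc
  have h2 := key fun x hx => (hc x hx).symm
  omega

end Adoption

/-! ### One step of Linial's color reduction -/

section Linial

variable {ι : Type*} [Fintype ι]

/-- The new color of a vertex of color `a` whose neighbors have the colors `A p`: a point of the
graph of its digit polynomial that is on none of the polynomials of the neighbors. Colors are
shifted by one, to have a nonzero polynomial. All neighbors count as still trying (time `q`). -/
noncomputable def linialColor (q d a : ℕ) (A : ι → ℕ) : ℕ :=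
  let x := adoptTime q d 0 (a + 1) (fun _ => True) (fun p => A p + 1) (fun _ => q)
  x * q + (digitPoly q d (a + 1) x).val

theorem linialColor_lt {q d a : ℕ} (hq : 0 < q) (A : ι → ℕ) : linialColor q d a A < q * q := by
  have : NeZero q := ⟨hq.ne'⟩
  unfold linialColor
  set x := adoptTime q d 0 (a + 1) (fun _ => True) (fun p => A p + 1) (fun _ => q)
  have hx : x + 1 ≤ q := adoptTime_lt hq _ _ _ _ _ _
  have hv := ZMod.val_lt (digitPoly q d (a + 1) x)
  dsimp only
  nlinarith

theorem linialColor_ne {κ : Type*} [Fintype κ] {q d D a a' : ℕ} {A : ι → ℕ} {A' : κ → ℕ}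
    (hq : q.Prime) (haq : a + 1 < q ^ d) (hA : ∀ p, A p + 1 < q ^ d ∧ A p ≠ a)
    (hcard : Fintype.card ι ≤ D) (hD : 2 * d * D < q) (p : ι) (hp : A p = a') :
    linialColor q d a' A' ≠ linialColor q d a A := by
  have : NeZero q := ⟨hq.pos.ne'⟩
  have h0 := conflicts_adoptTime_le (q := q) (d := d) (β := 0) (a := a + 1) (D := D)
    (P := fun _ : ι => True) (A := fun p => A p + 1) (X := fun _ => q) hq (by omega) haq
    (fun p _ => ⟨(hA p).1, by have := (hA p).2; omega⟩)
    (fun s _ => (card_le_univ s).trans hcard) (by omega)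
  have hx := adoptTime_lt hq.pos d 0 (a + 1) (fun _ : ι => True) (fun p => A p + 1) (fun _ => q)
  intro heq
  unfold linialColor at heq
  set x := adoptTime q d 0 (a + 1) (fun _ : ι => True) (fun p => A p + 1) (fun _ => q)
  set x' := adoptTime q d 0 (a' + 1) (fun _ : κ => True) (fun p => A' p + 1) (fun _ => q)
  dsimp only at heq
  have hv := ZMod.val_lt (digitPoly q d (a + 1) x)
  have hv' := ZMod.val_lt (digitPoly q d (a' + 1) x')
  have hxx : x' = x := by
    have := congrArg (· / q) heq
    simpa [Nat.add_div_of_dvd_right, Nat.div_eq_of_lt hv, Nat.div_eq_of_lt hv', hq.pos] using this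
  rw [hxx, Nat.add_left_cancel_iff, ZMod.val_injective q |>.eq_iff] at heq
  rw [conflicts, Nat.le_zero, card_eq_zero, eq_empty_iff_forall_notMem] at h0
  have hp0 := h0 p
  simp only [mem_filter] at hp0
  refine hp0 ⟨mem_univ p, trivial, ?_⟩
  rw [min_eq_right hx.le, hp, heq]

end Linial

/-! ### Selection and stabilization -/

open Classical in
/-- Some element with the property `P`, if there is one. The choice depends on `P` only. -/
noncomputable def pick {α : Type*} (P : α → Prop) : Option α :=
  if h : ∃ x, P x then some h.choose else none

theorem pick_spec {α : Type*} {P : α → Prop} {x : α} (h : pick P = some x) : P x := by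
  unfold pick at h
  split_ifs at h with hex
  exact Option.some.inj h ▸ hex.choose_spec

theorem pick_eq_none {α : Type*} {P : α → Prop} (h : pick P = none) (x : α) : ¬ P x := by
  unfold pick at h
  split_ifs at h with hex
  exact fun hx => hex ⟨x, hx⟩

/-- If two successive configurations agree at a level that rises by one in each round, and agreement
at level `L` is equality, then every configuration becomes a fixed point within `L` rounds. -/
theorem iterate_fixed_of_levels {α : Type*} {F : α → α} {R : ℕ → α → α → Prop} {L : ℕ}
    (h0 : ∀ s s', R 0 s s') (hstep : ∀ t s, R t s (F s) → R (t + 1) (F s) (F (F s)))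
    (hL : ∀ s s', R L s s' → s = s') {σ : ℕ → α} {t₀ : ℕ} (hσ : ∀ t ≥ t₀, σ (t + 1) = F (σ t)) :
    ∀ t ≥ t₀ + L, σ t = σ (t₀ + L) := by
  have hR : ∀ k t, t₀ + k ≤ t → R k (σ t) (F (σ t)) := by
    intro k
    induction k with
    | zero => exact fun t _ => h0 _ _
    | succ k ih =>
      intro t ht
      obtain ⟨t, rfl⟩ : ∃ t', t = t' + 1 := ⟨t - 1, by omega⟩
      rw [hσ t (by omega)]
      exact hstep _ _ (ih t (by omega))
  intro t ht
  induction t, ht using Nat.le_induction with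
  | base => rfl
  | succ t ht ih => rw [← ih, hσ t (by omega), ← hL _ _ (hR L t ht)]

/-! ### One stage: arbdefective classes and a sweep over them -/

/-- The color `y` is read as the point `(y % q₀, y / q₀)` of the plane over `ℤ/q₀`. It is on the
curve with shift `b` of a vertex of color `a` if it is on the graph of the digit polynomial of `a`
shifted by `b`. -/
def OnCurve {q₀ : ℕ} (d a : ℕ) (b : Fin q₀) (y : ℕ) : Prop :=
  digitPoly q₀ d a (y % q₀) + (b : ℕ) = ((y / q₀ : ℕ) : ZMod q₀)

theorem exists_onCurve {q₀ : ℕ} (hq₀ : 0 < q₀) (d a y : ℕ) : ∃ b : Fin q₀, OnCurve d a b y := by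
  have : NeZero q₀ := ⟨hq₀.ne'⟩
  refine ⟨⟨_, ZMod.val_lt (((y / q₀ : ℕ) : ZMod q₀) - digitPoly q₀ d a (y % q₀))⟩, ?_⟩
  simp [OnCurve]

open Classical in
/-- Curves of different colors have at most `d` common points. -/
theorem card_onCurve_inter_le {q₀ d a a' N : ℕ} (hq₀ : q₀.Prime) (ha : a < q₀ ^ d)
    (ha' : a' < q₀ ^ d) (hne : a ≠ a') (hN : N ≤ q₀ * q₀) (b b' : Fin q₀) :
    #{y : Fin N | OnCurve d a b y ∧ OnCurve d a' b' y} ≤ d := by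
  refine le_trans (card_le_card_of_injOn (fun y => (y : ℕ) % q₀) (fun y hy => ?_) ?_)
    (card_digitPoly_agree_le hq₀ ha ha' hne ((b' : ℕ) - (b : ℕ)))
  · obtain ⟨h1, h2⟩ := (mem_filter.1 hy).2
    refine mem_filter.2 ⟨mem_range.2 (Nat.mod_lt _ hq₀.pos), ?_⟩
    unfold OnCurve at h1 h2
    linear_combination h1 - h2
  · intro y hy z hz hyz
    have h1 : OnCurve d a b y := (mem_filter.1 hy).2.1
    have h2 : OnCurve d a b z := (mem_filter.1 hz).2.1
    dsimp only at hyz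
    unfold OnCurve at h1 h2
    rw [hyz, h2, ZMod.natCast_eq_natCast_iff',
      Nat.mod_eq_of_lt (Nat.div_lt_of_lt_mul (by omega)),
      Nat.mod_eq_of_lt (Nat.div_lt_of_lt_mul (by omega))] at h1
    ext
    rw [← Nat.div_add_mod (y : ℕ) q₀, ← Nat.div_add_mod (z : ℕ) q₀, h1, hyz]

/-- The memory of a vertex for one stage: the time at which it adopts its class, the shift of its
curve of candidate colors (`none` if it gave up), and its color (`none` as long as it has none). -/
abbrev Stage (Δ q₀ q : ℕ) : Type := Fin q × Option (Fin q₀) × Option (Fin (Δ + 1))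

/-- What a stage knows of a vertex: its color in a proper coloring with many colors, the color it
was given by earlier stages, if any, and its memory for this stage. -/
structure StageView (Δ q₀ q : ℕ) where
  big : ℕ
  fixed : Option (Fin (Δ + 1))
  mem : Stage Δ q₀ q

namespace StageView

variable {Δ q₀ q : ℕ}

/-- The adoption time. -/
def time (w : StageView Δ q₀ q) : ℕ := w.mem.1

/-- The shift of the curve of candidate colors. -/
def shift (w : StageView Δ q₀ q) : Option (Fin q₀) := w.mem.2.1

/-- The color at the end of the stage. -/
def color (w : StageView Δ q₀ q) : Option (Fin (Δ + 1)) := w.mem.2.2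

/-- The class adopted by a vertex. -/
noncomputable def cls (d : ℕ) (w : StageView Δ q₀ q) : ℕ := (digitPoly q d w.big w.time).val

variable {ι : Type*} [Fintype ι]

open Classical in
/-- The colors that are taken neither by an earlier stage nor by the neighbors in smaller
classes. -/
noncomputable def palette (d : ℕ) (w : StageView Δ q₀ q) (ν : ι → StageView Δ q₀ q) :
    Finset (Fin (Δ + 1)) :=
  {y | ∀ p, (ν p).fixed ≠ some y ∧ ((ν p).cls d < w.cls d → (ν p).color ≠ some y)}

theorem mem_palette {d : ℕ} {w : StageView Δ q₀ q} {ν : ι → StageView Δ q₀ q} {y : Fin (Δ + 1)} :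
    y ∈ w.palette d ν ↔
      ∀ p, (ν p).fixed ≠ some y ∧ ((ν p).cls d < w.cls d → (ν p).color ≠ some y) := by
  simp [palette]

/-- The new adoption time: only uncolored neighbors compete. -/
noncomputable def newTime (d β : ℕ) (w : StageView Δ q₀ q) (ν : ι → StageView Δ q₀ q) : ℕ :=
  adoptTime q d β w.big (fun p => (ν p).fixed = none) (fun p => (ν p).big) (fun p => (ν p).time)

open Classical in
/-- The new shift: one for which more than `d * β` candidate colors are available. -/
noncomputable def newShift (d β : ℕ) (w : StageView Δ q₀ q) (ν : ι → StageView Δ q₀ q) :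
    Option (Fin q₀) :=
  pick fun b => w.fixed = none ∧
    d * β < #({y ∈ w.palette d ν | OnCurve d w.big b y} : Finset (Fin (Δ + 1)))

/-- The new color: an available color on the own curve that is on none of the curves of the
neighbors in the same class with at most the same adoption time. -/
noncomputable def newColor (d : ℕ) (w : StageView Δ q₀ q) (ν : ι → StageView Δ q₀ q) :
    Option (Fin (Δ + 1)) :=
  w.fixed.or <| pick fun y => y ∈ w.palette d ν ∧ (∃ b, w.shift = some b ∧ OnCurve d w.big b y) ∧
    ∀ p, (ν p).cls d = w.cls d → (ν p).time ≤ w.time → (ν p).fixed = none →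
      ∀ b, (ν p).shift = some b → ¬ OnCurve d (ν p).big b y

/-- The memory for this stage after one round. -/
noncomputable def next (d β : ℕ) (w : StageView Δ q₀ q) (ν : ι → StageView Δ q₀ q) :
    Stage Δ q₀ q :=
  (⟨w.newTime d β ν, adoptTime_lt w.mem.1.pos _ _ _ _ _ _⟩, w.newShift d β ν, w.newColor d ν)

end StageView

section StageRound

variable {V : Type*} {ι : V → Type*} [∀ v, Fintype (ι v)] {Δ q₀ q : ℕ}

/-- One round of a stage on a graph given by the neighbors `nb v p` of the vertices `v`, with
input `big` and `fixed`. -/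
noncomputable def stageRound (nb : ∀ v, ι v → V) (d β : ℕ) (big : V → ℕ)
    (fixed : V → Option (Fin (Δ + 1))) (s : V → Stage Δ q₀ q) (v : V) : Stage Δ q₀ q :=
  StageView.next d β ⟨big v, fixed v, s v⟩ fun p => ⟨big (nb v p), fixed (nb v p), s (nb v p)⟩

/-- Agreement of two memories up to level `t`: adoption times become final from small to large,
then shifts and colors in the order of the classes. -/
def StageAgree (d : ℕ) (big : V → ℕ) (t : ℕ) (s s' : V → Stage Δ q₀ q) : Prop :=
  ∀ v, min ((s v).1 : ℕ) t = min ((s' v).1 : ℕ) t ∧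
    (q + 2 * (digitPoly q d (big v) (s v).1).val + 1 ≤ t → (s v).2.1 = (s' v).2.1) ∧
    (q + 2 * (digitPoly q d (big v) (s v).1).val + 2 ≤ t → (s v).2.2 = (s' v).2.2)

theorem StageAgree.step {nb : ∀ v, ι v → V} {d β t : ℕ} {big : V → ℕ}
    {fixed : V → Option (Fin (Δ + 1))} {s s' : V → Stage Δ q₀ q}
    (hs : s' = stageRound nb d β big fixed s) (h : StageAgree d big t s s') :
    StageAgree d big (t + 1) s' (stageRound nb d β big fixed s') := by
  have htime : ∀ v, min ((s' v).1 : ℕ) (t + 1)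
      = min ((stageRound nb d β big fixed s' v).1 : ℕ) (t + 1) := by
    intro v
    nth_rw 1 [hs]
    exact min_adoptTime_congr fun p => (h (nb v p)).1
  -- from level `q` on all adoption times, hence all classes, are final
  have heq : q ≤ t → ∀ v, (s' v).1 = (s v).1 ∧ (stageRound nb d β big fixed s' v).1 = (s' v).1 := by
    intro hqt v
    have := (h v).1
    have := htime v
    have := (s v).1.isLt
    have := (s' v).1.isLt
    have := (stageRound nb d β big fixed s' v).1.isLt
    exact ⟨Fin.ext (by omega), Fin.ext (by omega)⟩
  intro v
  refine ⟨htime v, fun hle => ?_, fun hle => ?_⟩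
  all_goals
    have ht := heq (by omega)
    rw [(ht v).1] at hle
    have hpal : StageView.palette d ⟨big v, fixed v, s v⟩
          (fun p => (⟨big (nb v p), fixed (nb v p), s (nb v p)⟩ : StageView Δ q₀ q))
        = StageView.palette d ⟨big v, fixed v, s' v⟩
          (fun p => (⟨big (nb v p), fixed (nb v p), s' (nb v p)⟩ : StageView Δ q₀ q)) := by
      ext y
      simp only [StageView.mem_palette, StageView.cls, StageView.time, StageView.color, (ht _).1]
      refine forall_congr' fun p => and_congr_right fun _ =>
        imp_congr_right fun hlt => ?_
      rw [(h (nb v p)).2.2 (by omega)]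
  · conv_lhs => rw [hs]
    change StageView.newShift _ _ _ _ = StageView.newShift _ _ _ _
    simp only [StageView.newShift, hpal]
  · conv_lhs => rw [hs]
    change StageView.newColor _ _ _ = StageView.newColor _ _ _
    simp only [StageView.newColor, hpal, StageView.cls, StageView.time,
      StageView.shift, (ht _).1]
    congr 2
    ext y
    rw [(h v).2.1 (by omega)]
    refine and_congr_right fun _ => and_congr_right fun _ => forall_congr' fun p =>
      imp_congr_right fun hcls => ?_
    rw [(h (nb v p)).2.1 (by omega)]

theorem stage_stabilizes {nb : ∀ v, ι v → V} {d β : ℕ} {big : V → ℕ}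
    {fixed : V → Option (Fin (Δ + 1))} {σ : ℕ → V → Stage Δ q₀ q} {t₀ : ℕ}
    (hσ : ∀ t ≥ t₀, σ (t + 1) = stageRound nb d β big fixed (σ t)) :
    ∀ t ≥ t₀ + 3 * q, σ t = σ (t₀ + 3 * q) := by
  refine iterate_fixed_of_levels (R := StageAgree d big) ?_ (fun t s => StageAgree.step rfl) ?_ hσ
  · exact fun s s' v => ⟨by simp, by omega, by omega⟩
  · intro s s' h
    funext v
    obtain ⟨h1, h2, h3⟩ := h v
    have hq : NeZero q := ⟨(s v).1.pos.ne'⟩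
    have hv := ZMod.val_lt (digitPoly q d (big v) (s v).1)
    refine Prod.ext (Fin.ext ?_) (Prod.ext (h2 (by omega)) (h3 (by omega)))
    have := (s v).1.isLt
    have := (s' v).1.isLt
    omega

/-- The facts about a graph of maximum degree at most `Δ` and the input of a stage that make the
stage work: `big` is a proper coloring with few enough colors, `fixed` is a proper partial coloring,
and every vertex without a color has at most `D` such neighbors. -/
structure StageInput (nb : ∀ v, ι v → V) (d D : ℕ) (q₀ q : ℕ) (big : V → ℕ)
    (fixed : V → Option (Fin (Δ + 1))) : Prop where
  symm : ∀ v p, ∃ p', nb (nb v p) p' = v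
  card_le : ∀ v, Fintype.card (ι v) ≤ Δ
  big_ne_zero : ∀ v, big v ≠ 0
  big_lt : ∀ v, big v < q ^ d
  big_lt' : ∀ v, big v < q₀ ^ d
  big_proper : ∀ v p, big (nb v p) ≠ big v
  fixed_proper : ∀ v p y, fixed v = some y → fixed (nb v p) ≠ some y
  free_le : ∀ v, fixed v = none → ∀ s : Finset (ι v), (∀ p ∈ s, fixed (nb v p) = none) → #s ≤ D

section Fixed

variable {nb : ∀ v, ι v → V} {d β D : ℕ} {big : V → ℕ} {fixed : V → Option (Fin (Δ + 1))}
  {s : V → Stage Δ q₀ q}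

theorem stage_color_of_fixed (hs : s = stageRound nb d β big fixed s) {v : V} {y : Fin (Δ + 1)}
    (h : fixed v = some y) : (s v).2.2 = some y := by
  rw [hs]
  change StageView.newColor _ _ _ = _
  simp [StageView.newColor, h]

/-- A vertex colored in this stage: its color is in its palette and on its curve, and avoids the
curves of the preceding vertices of its class. -/
theorem stage_color_of_free (hs : s = stageRound nb d β big fixed s) {v : V} (h : fixed v = none) :
    (s v).2.2 = pick fun y => y ∈ StageView.palette d ⟨big v, fixed v, s v⟩
        (fun p => (⟨big (nb v p), fixed (nb v p), s (nb v p)⟩ : StageView Δ q₀ q)) ∧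
      (∃ b, (s v).2.1 = some b ∧ OnCurve d (big v) b y) ∧
      ∀ p, (digitPoly q d (big (nb v p)) (s (nb v p)).1).val = (digitPoly q d (big v) (s v).1).val →
        (s (nb v p)).1 ≤ (s v).1 → fixed (nb v p) = none →
        ∀ b, (s (nb v p)).2.1 = some b → ¬ OnCurve d (big (nb v p)) b y := by
  conv_lhs => rw [hs]
  change StageView.newColor _ _ _ = _
  simp only [StageView.newColor, h, Option.none_or]
  rfl

theorem stage_proper (hI : StageInput nb d D q₀ q big fixed)
    (hs : s = stageRound nb d β big fixed s) (v : V) (p : ι v) (y : Fin (Δ + 1))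
    (hv : (s v).2.2 = some y) : (s (nb v p)).2.2 ≠ some y := by
  -- it suffices to look at the vertex that comes later in the order of classes and times
  have key : ∀ v p, (s v).2.2 = some y → (s (nb v p)).2.2 = some y →
      ((digitPoly q d (big (nb v p)) (s (nb v p)).1).val < (digitPoly q d (big v) (s v).1).val ∨
        (digitPoly q d (big (nb v p)) (s (nb v p)).1).val = (digitPoly q d (big v) (s v).1).val ∧
        (s (nb v p)).1 ≤ (s v).1) → False := by
    intro v p hv hu hle
    rcases hfv : fixed v with _ | y'
    · have h1 := hv
      rw [stage_color_of_free hs hfv] at h1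
      obtain ⟨hpal, -, hout⟩ := pick_spec h1
      have hpal := StageView.mem_palette.1 hpal p
      rcases hfu : fixed (nb v p) with _ | z
      · rcases hle with hlt | ⟨heq, htime⟩
        · exact hpal.2 hlt hu
        · have h2 := hu
          rw [stage_color_of_free hs hfu] at h2
          obtain ⟨-, ⟨b, hb, hcurve⟩, -⟩ := pick_spec h2
          exact hout p heq htime hfu b hb hcurve
      · have := stage_color_of_fixed hs hfu
        exact hpal.1 (by rw [← hu, this]; exact hfu)
    · have h1 := stage_color_of_fixed hs hfv
      rw [hv] at h1
      obtain rfl := Option.some.inj h1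
      rcases hfu : fixed (nb v p) with _ | z
      · have h2 := hu
        rw [stage_color_of_free hs hfu] at h2
        obtain ⟨p', hp'⟩ := hI.symm v p
        have := (StageView.mem_palette.1 (pick_spec h2).1 p').1
        simp only [hp'] at this
        exact this hfv
      · have := stage_color_of_fixed hs hfu
        rw [hu] at this
        exact hI.fixed_proper v p y hfv (by rw [this, hfu])
  intro hu
  obtain ⟨p', hp'⟩ := hI.symm v p
  have k1 := key v p hv hu
  have k2 := key (nb v p) p' hu (by rw [hp']; exact hv)
  rw [hp'] at k2
  generalize (digitPoly q d (big (nb v p)) (s (nb v p)).1).val = m at k1 k2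
  generalize (digitPoly q d (big v) (s v).1).val = n at k1 k2
  rcases lt_trichotomy m n with h | h | h
  · exact k1 (Or.inl h)
  · rcases le_total (s (nb v p)).1 (s v).1 with h' | h'
    · exact k1 (Or.inr ⟨h, h'⟩)
    · exact k2 (Or.inr ⟨h.symm, h'⟩)
  · exact k2 (Or.inl h)

open Classical in
/-- A vertex that has chosen a shift finds a color: each of the at most `β` preceding vertices of
its class spoils at most `d` of the more than `d * β` candidates. -/
theorem stage_shift_eq_none (hq : q.Prime) (hq₀ : q₀.Prime) (hΔ : Δ + 1 ≤ q₀ * q₀)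
    (hD : 2 * d * D < q * (β + 1)) (hI : StageInput nb d D q₀ q big fixed)
    (hs : s = stageRound nb d β big fixed s) {v : V} (hv : (s v).2.2 = none) :
    (s v).2.1 = none := by
  have hfree : fixed v = none := by
    rcases hf : fixed v with _ | y
    · rfl
    · simp [stage_color_of_fixed hs hf] at hv
  rw [stage_color_of_free hs hfree] at hv
  have hnone := pick_eq_none hv
  by_contra hshift
  obtain ⟨b, hb⟩ := Option.ne_none_iff_exists'.1 hshift
  have hmany := hb
  rw [hs] at hmany
  change StageView.newShift _ _ _ _ = _ at hmany
  have hmany := (pick_spec hmany).2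
  have hconf := conflicts_adoptTime_le (q := q) (d := d) (β := β) (a := big v) (D := D)
    (P := fun p => fixed (nb v p) = none) (A := fun p => big (nb v p))
    (X := fun p => (s (nb v p)).1) hq (hI.big_ne_zero v) (hI.big_lt v)
    (fun p _ => ⟨hI.big_lt _, hI.big_proper v p⟩) (hI.free_le v hfree) hD
  have htime : adoptTime q d β (big v) (fun p => fixed (nb v p) = none) (fun p => big (nb v p))
      (fun p => (s (nb v p)).1) = (s v).1 := by
    conv_rhs => rw [hs]
    rfl
  rw [htime] at hconf
  set L := StageView.palette d ⟨big v, fixed v, s v⟩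
    (fun p => (⟨big (nb v p), fixed (nb v p), s (nb v p)⟩ : StageView Δ q₀ q))
  let O : Finset (ι v) := {p | fixed (nb v p) = none ∧
    digitPoly q d (big (nb v p)) (min (s (nb v p)).1 (s v).1 : ℕ) = digitPoly q d (big v) (s v).1}
  have hO : #O ≤ β := by
    simp only [conflicts] at hconf
    convert hconf
  -- the candidates that are spoiled by the neighbor at `p`
  let bad (p : ι v) : Finset (Fin (Δ + 1)) :=
    {y | OnCurve d (big v) b y ∧ ∃ b', (s (nb v p)).2.1 = some b' ∧ OnCurve d (big (nb v p)) b' y}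
  have hbad : ∀ p ∈ O, #(bad p) ≤ d := by
    intro p _
    rcases hsh : (s (nb v p)).2.1 with _ | b'
    · simp [bad, hsh]
    · simpa [bad, hsh] using card_onCurve_inter_le (d := d) hq₀ (hI.big_lt' v) (hI.big_lt' (nb v p))
        (hI.big_proper v p).symm hΔ b b'
  have hsub : ({y ∈ L | OnCurve d (big v) b y} : Finset (Fin (Δ + 1))) ⊆ O.biUnion bad := by
    intro y hy
    obtain ⟨hyL, hyc⟩ := mem_filter.1 hy
    have := hnone y
    push Not at this
    obtain ⟨p, hcls, hle, hfp, b', hb', hc'⟩ := this hyL ⟨b, hb, hyc⟩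
    have : NeZero q := ⟨hq.pos.ne'⟩
    refine mem_biUnion.2 ⟨p, mem_filter.2 ⟨mem_univ _, hfp, ?_⟩,
      mem_filter.2 ⟨mem_univ _, hyc, b', hb', hc'⟩⟩
    rw [min_eq_left (Fin.le_def.1 hle)]
    exact ZMod.val_injective q hcls
  have h1 := (card_le_card hsub).trans (card_biUnion_le_card_mul _ _ _ hbad)
  have h2 : #O * d ≤ β * d := Nat.mul_le_mul_right _ hO
  have h3 : d * β < #({y ∈ L | OnCurve d (big v) b y} : Finset (Fin (Δ + 1))) := hmany
  rw [mul_comm] at h3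
  omega

open Classical in
/-- A vertex that gives up has a small palette, hence few uncolored neighbors. -/
theorem stage_free_lt (hq : q.Prime) (hq₀ : q₀.Prime) (hΔ : Δ + 1 ≤ q₀ * q₀)
    (hD : 2 * d * D < q * (β + 1)) (hI : StageInput nb d D q₀ q big fixed)
    (hs : s = stageRound nb d β big fixed s) {v : V} (hv : (s v).2.2 = none) :
    #{p | (s (nb v p)).2.2 = none} < q₀ * (d * β) := by
  have hshift := stage_shift_eq_none hq hq₀ hΔ hD hI hs hv
  have hfree : fixed v = none := by
    rcases hf : fixed v with _ | y
    · rfl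
    · simp [stage_color_of_fixed hs hf] at hv
  rw [hs] at hshift
  change StageView.newShift _ _ _ _ = _ at hshift
  have hfew := pick_eq_none hshift
  set L := StageView.palette d ⟨big v, fixed v, s v⟩
    (fun p => (⟨big (nb v p), fixed (nb v p), s (nb v p)⟩ : StageView Δ q₀ q)) with hL
  -- every color is on the curve for some shift, and no shift has more than `d * β` candidates
  have hLcard : #L ≤ q₀ * (d * β) := by
    have hsub : L ⊆ univ.biUnion fun b : Fin q₀ => {y ∈ L | OnCurve d (big v) b y} := by
      intro y hy
      obtain ⟨b, hb⟩ := exists_onCurve hq₀.pos d (big v) y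
      exact mem_biUnion.2 ⟨b, mem_univ _, mem_filter.2 ⟨hy, hb⟩⟩
    refine (card_le_card hsub).trans ((card_biUnion_le_card_mul _ _ (d * β) fun b _ => ?_).trans
      (by simp))
    have := hfew b
    simp only [hfree, true_and, not_lt] at this
    simpa only [hL, hfree] using this
  -- every color missing from the palette is the color of a neighbor
  have hcompl : #Lᶜ ≤ #{p | (s (nb v p)).2.2 ≠ none} := by
    rw [← card_image_of_injective Lᶜ (Option.some_injective _)]
    refine (card_le_card ?_).trans (card_image_le (f := fun p => (s (nb v p)).2.2))
    intro o ho
    obtain ⟨y, hy, rfl⟩ := mem_image.1 ho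
    rw [mem_compl, StageView.mem_palette] at hy
    push Not at hy
    obtain ⟨p, hp⟩ := hy
    have hcol : (s (nb v p)).2.2 = some y := by
      by_cases hf : fixed (nb v p) = some y
      · exact stage_color_of_fixed hs hf
      · exact (hp hf).2
    exact mem_image.2 ⟨p, mem_filter.2 ⟨mem_univ _, by simp [hcol]⟩, hcol⟩
  have h1 := card_add_card_compl L
  have h2 := card_filter_add_card_filter_not (s := (univ : Finset (ι v)))
    (fun p => (s (nb v p)).2.2 = none)
  have h3 := hI.card_le v
  simp only [Fintype.card_fin] at h1
  simp only [card_univ] at h2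
  simp only [ne_eq] at hcompl
  omega

end Fixed

end StageRound

/-! ### Parameters -/

/-- The least prime above `k`. -/
noncomputable def primeAbove (k : ℕ) : ℕ :=
  open Classical in Nat.find (Nat.exists_infinite_primes (k + 1))

theorem primeAbove_prime (k : ℕ) : (primeAbove k).Prime := by
  classical exact (Nat.find_spec (Nat.exists_infinite_primes (k + 1))).2

theorem lt_primeAbove (k : ℕ) : k < primeAbove k := by
  classical exact (Nat.find_spec (Nat.exists_infinite_primes (k + 1))).1

theorem primeAbove_le {k : ℕ} (hk : k ≠ 0) : primeAbove k ≤ 2 * k := by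
  classical
  obtain ⟨p, hp, hlt, hle⟩ := Nat.exists_prime_lt_and_le_two_mul k hk
  exact (Nat.find_min' _ ⟨hlt, hp⟩).trans hle

/-- An exponent `g ≥ 1` for which `2 ^ g` is the fourth root of `Δ` up to a constant factor. -/
def rootExp (Δ : ℕ) : ℕ := Nat.clog 16 Δ + 1

theorem rootExp_pos (Δ : ℕ) : 0 < rootExp Δ := Nat.succ_pos _

theorem le_two_pow_rootExp (Δ : ℕ) : Δ ≤ 2 ^ (4 * rootExp Δ) := by
  calc Δ ≤ 16 ^ Nat.clog 16 Δ := Nat.le_pow_clog (by norm_num) _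
    _ ≤ 16 ^ rootExp Δ := Nat.pow_le_pow_right (by norm_num) (Nat.le_succ _)
    _ = 2 ^ (4 * rootExp Δ) := by rw [pow_mul]; norm_num

theorem two_pow_rootExp_le {Δ : ℕ} (hΔ : 2 ≤ Δ) : 2 ^ (4 * rootExp Δ) ≤ 256 * Δ := by
  have h : 16 ^ (Nat.clog 16 Δ - 1) ≤ Δ :=
    (Nat.pow_pred_clog_lt_self (b := 16) (by norm_num) (show 1 < Δ by omega)).le
  have hpos := Nat.clog_pos (b := 16) (by norm_num) (show 1 < Δ by omega)
  rw [pow_mul, show rootExp Δ = Nat.clog 16 Δ - 1 + 2 by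
    unfold rootExp; omega, pow_add]
  norm_num
  omega

/-- The colors after `i` steps of Linial's reduction have `bitLen n Δ i` bits. -/
def bitLen (n Δ : ℕ) : ℕ → ℕ
  | 0 => Nat.clog 2 n
  | i + 1 => 2 * (4 * rootExp Δ + Nat.clog 2 (bitLen n Δ i) + 2)

/-- The field size for the step from `bitLen n Δ i` to `bitLen n Δ (i + 1)` bits. -/
noncomputable def linialPrime (n Δ i : ℕ) : ℕ :=
  primeAbove (2 ^ (4 * rootExp Δ + Nat.clog 2 (bitLen n Δ i) + 1))

theorem two_mul_bitLen_mul_lt_linialPrime (n Δ i : ℕ) :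
    2 * bitLen n Δ i * Δ < linialPrime n Δ i := by
  refine lt_of_le_of_lt ?_ (lt_primeAbove _)
  calc 2 * bitLen n Δ i * Δ
      ≤ 2 * 2 ^ Nat.clog 2 (bitLen n Δ i) * 2 ^ (4 * rootExp Δ) :=
        Nat.mul_le_mul (Nat.mul_le_mul_left _ (Nat.le_pow_clog (by norm_num) _))
          (le_two_pow_rootExp Δ)
    _ = _ := by ring

theorem linialPrime_mul_self_le (n Δ i : ℕ) :
    linialPrime n Δ i * linialPrime n Δ i ≤ 2 ^ bitLen n Δ (i + 1) := by
  have h := primeAbove_le (k := 2 ^ (4 * rootExp Δ + Nat.clog 2 (bitLen n Δ i) + 1)) (by positivity)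
  calc _ ≤ _ := Nat.mul_le_mul h h
    _ = _ := by rw [bitLen]; ring

theorem two_lt_linialPrime (n Δ i : ℕ) : 2 < linialPrime n Δ i := by
  refine lt_of_le_of_lt ?_ (lt_primeAbove _)
  exact le_self_pow₀ (by norm_num) (by omega)

theorem clog_two_le (m : ℕ) : Nat.clog 2 m ≤ m / 16 + 5 := by
  refine Nat.clog_le_of_le_pow ?_
  have := Nat.lt_two_pow_self (n := m / 16)
  rw [pow_add]
  omega

theorem two_mul_bitLen_succ_le {n Δ i : ℕ} (hi : 100 * rootExp Δ < bitLen n Δ i) :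
    2 * bitLen n Δ (i + 1) ≤ bitLen n Δ i := by
  have h := clog_two_le (bitLen n Δ i)
  have hg := rootExp_pos Δ
  rw [bitLen]
  omega

theorem exists_bitLen_le (n Δ : ℕ) : ∃ i, bitLen n Δ i ≤ 100 * rootExp Δ := by
  by_contra! h
  have key : ∀ i, bitLen n Δ i + i ≤ bitLen n Δ 0 := by
    intro i
    induction i with
    | zero => rfl
    | succ i ih =>
      have := two_mul_bitLen_succ_le (h i)
      have := h (i + 1)
      omega
  have := key (bitLen n Δ 0 + 1)
  omega

/-- The number of steps of Linial's reduction: until the colors have `O(log Δ)` bits. -/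
noncomputable def depth (n Δ : ℕ) : ℕ := sInf {i | bitLen n Δ i ≤ 100 * rootExp Δ}

theorem bitLen_depth_le (n Δ : ℕ) : bitLen n Δ (depth n Δ) ≤ 100 * rootExp Δ :=
  Nat.sInf_mem (exists_bitLen_le n Δ)

theorem lt_bitLen_of_lt_depth {n Δ i : ℕ} (hi : i < depth n Δ) : 100 * rootExp Δ < bitLen n Δ i :=
  not_le.1 fun h => Nat.notMem_of_lt_sInf hi h

/-- The numbers of bits decrease geometrically. -/
theorem sum_bitLen_le (n Δ : ℕ) :
    ∑ i ∈ range (depth n Δ), bitLen n Δ (i + 1) ≤ Nat.clog 2 n := by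
  have key : ∀ k ≤ depth n Δ,
      ∑ i ∈ range k, bitLen n Δ (i + 1) + bitLen n Δ k ≤ Nat.clog 2 n := by
    intro k
    induction k with
    | zero => simp [bitLen]
    | succ k ih =>
      intro hk
      have h1 := ih (by omega)
      have h2 := two_mul_bitLen_succ_le
        (lt_bitLen_of_lt_depth (n := n) (Δ := Δ) (i := k) (by omega))
      rw [sum_range_succ]
      omega
  exact (Nat.le_add_right _ _).trans (key _ le_rfl)

/-! ### The iterated logarithm -/

/-- The infimum in `logStar` is over a nonempty set, so it is not the junk value zero. -/
theorem exists_iterate_logb_le_one (x : ℝ) : ∃ k, (Real.logb 2)^[k] x ≤ 1 := by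
  have key : ∀ N : ℕ, ∀ x : ℝ, x ≤ N + 1 → ∃ k, (Real.logb 2)^[k] x ≤ 1 := by
    intro N
    induction N with
    | zero => exact fun x hx => ⟨0, by simpa using hx⟩
    | succ N ih =>
      intro x hx
      rcases le_or_gt x 1 with h1 | h1
      · exact ⟨0, h1⟩
      obtain ⟨k, hk⟩ := ih (Real.logb 2 x) (by
        rw [Real.logb_le_iff_le_rpow (by norm_num) (by linarith)]
        push_cast at hx
        refine hx.trans ?_
        rw [show ((N : ℝ) + 1) = ((N + 1 : ℕ) : ℝ) by push_cast; ring, Real.rpow_natCast]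
        exact_mod_cast Nat.lt_two_pow_self (n := N + 1))
      exact ⟨k + 1, by rwa [Function.iterate_succ_apply]⟩
  obtain ⟨N, hN⟩ := exists_nat_ge x
  exact key N x (by linarith)

theorem lt_logStar {x : ℝ} {k : ℕ} (h : ∀ j ≤ k, 1 < (Real.logb 2)^[j] x) : k < logStar x := by
  by_contra! hle
  have hmem : logStar x ∈ {k : ℕ | (Real.logb 2)^[k] x ≤ 1} :=
    Nat.sInf_mem (exists_iterate_logb_le_one x)
  have h1 : (Real.logb 2)^[logStar x] x ≤ 1 := hmem
  linarith [h _ hle]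

theorem clog_two_le_logb {m : ℕ} (hm : 2 ≤ m) : (Nat.clog 2 m : ℝ) ≤ Real.logb 2 m + 1 := by
  rw [← Real.natCeil_logb_natCast 2 m]
  have h1 : (1 : ℝ) ≤ m := by exact_mod_cast (by omega : 1 ≤ m)
  exact (Nat.ceil_lt_add_one (Real.logb_nonneg (by norm_num) h1)).le

/-- As long as the reduction goes on, the number of bits after `i` steps is bounded by a multiple of
the `(i + 1)`-fold logarithm of `n`: the contribution of `Δ` is negligible. -/
theorem depth_le_logStar (n Δ : ℕ) : depth n Δ ≤ logStar n := by
  rcases Nat.eq_zero_or_pos (depth n Δ) with h0 | hpos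
  · omega
  have hbig : ∀ i < depth n Δ, 100 < bitLen n Δ i := fun i hi => by
    have := lt_bitLen_of_lt_depth hi
    have := rootExp_pos Δ
    omega
  have hn : 2 ≤ n := by
    by_contra! h
    have := hbig 0 hpos
    rw [bitLen, Nat.clog_of_right_le_one (by omega)] at this
    omega
  have hL : ∀ i < depth n Δ, (bitLen n Δ i : ℝ) ≤ 16 * (Real.logb 2)^[i + 1] n := by
    intro i
    induction i with
    | zero =>
      intro hi
      have h1 := clog_two_le_logb hn
      have h2 : (100 : ℝ) < bitLen n Δ 0 := by exact_mod_cast hbig 0 hi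
      simp only [bitLen] at h2 ⊢
      simp only [zero_add, Function.iterate_one]
      linarith
    | succ i ih =>
      intro hi
      have hb := hbig i (by omega)
      have hb' : (100 : ℝ) < bitLen n Δ (i + 1) := by exact_mod_cast hbig (i + 1) hi
      have h3 : bitLen n Δ (i + 1) ≤ 3 * Nat.clog 2 (bitLen n Δ i) := by
        have h4 := lt_bitLen_of_lt_depth hi
        have hg := rootExp_pos Δ
        have h5 : 4 ≤ Nat.clog 2 (bitLen n Δ i) := by
          by_contra! hlt
          have := Nat.le_pow_clog (b := 2) (by norm_num) (bitLen n Δ i)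
          have := Nat.pow_le_pow_right (n := 2) (by norm_num) hlt.le
          omega
        rw [bitLen] at h4 ⊢
        omega
      have h6 := clog_two_le_logb (m := bitLen n Δ i) (by omega)
      have h7 : (bitLen n Δ (i + 1) : ℝ) ≤ 3 * Nat.clog 2 (bitLen n Δ i) := by exact_mod_cast h3
      have hih := ih (by omega)
      have hbr : (100 : ℝ) < bitLen n Δ i := by exact_mod_cast hb
      have h8 : Real.logb 2 (bitLen n Δ i) ≤ 4 + (Real.logb 2)^[i + 1 + 1] n := by
        rw [Function.iterate_succ_apply' (Real.logb 2) (i + 1)]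
        calc Real.logb 2 (bitLen n Δ i) ≤ Real.logb 2 (16 * (Real.logb 2)^[i + 1] n) :=
              Real.logb_le_logb_of_le (by norm_num) (by linarith) hih
          _ = 4 + _ := by
            rw [Real.logb_mul (by norm_num) (by linarith),
              show (16 : ℝ) = 2 ^ (4 : ℝ) by norm_num, Real.logb_rpow (by norm_num) (by norm_num)]
      linarith
  refine (lt_logStar fun j hj => ?_).le
  rcases j with _ | j
  · simp only [Function.iterate_zero, id]
    exact_mod_cast hn
  · have h1 := hL j (by omega)
    have h2 : (100 : ℝ) < bitLen n Δ j := by exact_mod_cast hbig j (by omega)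
    linarith

/-! ### The field sizes of the stages -/

/-- The field size for the plane of colors. -/
noncomputable def planePrime (Δ : ℕ) : ℕ := primeAbove (2 ^ (2 * rootExp Δ))

/-- The number of classes of the first stage, whose classes have outdegree at most
`2 ^ rootExp Δ`. -/
noncomputable def classPrime (Δ : ℕ) : ℕ := primeAbove (100 * 2 ^ (3 * rootExp Δ))

/-- The number of classes of the second stage, whose classes are independent. -/
noncomputable def classPrime' (Δ : ℕ) : ℕ := primeAbove (10000 * 2 ^ (3 * rootExp Δ))

theorem planePrime_le (Δ : ℕ) : planePrime Δ ≤ 2 * 2 ^ (2 * rootExp Δ) :=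
  primeAbove_le (by positivity)

theorem classPrime_le (Δ : ℕ) : classPrime Δ ≤ 200 * 2 ^ (3 * rootExp Δ) :=
  (primeAbove_le (by positivity)).trans (by omega)

theorem classPrime'_le (Δ : ℕ) : classPrime' Δ ≤ 20000 * 2 ^ (3 * rootExp Δ) :=
  (primeAbove_le (by positivity)).trans (by omega)

theorem lt_planePrime_mul_self (Δ : ℕ) : Δ + 1 ≤ planePrime Δ * planePrime Δ := by
  have h : 2 ^ (2 * rootExp Δ) < planePrime Δ := lt_primeAbove _
  have h' := Nat.mul_le_mul h h
  have h2 := le_two_pow_rootExp Δ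
  have h3 : 2 ^ (4 * rootExp Δ) = 2 ^ (2 * rootExp Δ) * 2 ^ (2 * rootExp Δ) := by ring
  rw [h3] at h2
  generalize 2 ^ (2 * rootExp Δ) = m at h' h2
  simp only [Nat.succ_eq_add_one] at h'
  nlinarith

/-- Fifty digits suffice for the colors that Linial's reduction ends with. -/
theorem lt_pow_fifty {n Δ q c : ℕ} (hq : 2 ^ (2 * rootExp Δ) < q)
    (hc : c < 2 ^ bitLen n Δ (depth n Δ)) : c + 1 < q ^ 50 := by
  calc c + 1 ≤ 2 ^ bitLen n Δ (depth n Δ) := hc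
    _ ≤ 2 ^ (100 * rootExp Δ) := Nat.pow_le_pow_right (by norm_num) (bitLen_depth_le n Δ)
    _ = (2 ^ (2 * rootExp Δ)) ^ 50 := by rw [← pow_mul]; ring_nf
    _ < q ^ 50 := Nat.pow_lt_pow_left hq (by norm_num)

theorem two_pow_lt_planePrime (Δ : ℕ) : 2 ^ (2 * rootExp Δ) < planePrime Δ := lt_primeAbove _

theorem two_pow_lt_classPrime (Δ : ℕ) : 2 ^ (2 * rootExp Δ) < classPrime Δ := by
  refine lt_of_le_of_lt ?_ (lt_primeAbove _)
  have := Nat.pow_le_pow_right (n := 2) (by norm_num) (show 2 * rootExp Δ ≤ 3 * rootExp Δ by omega)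
  omega

theorem two_pow_lt_classPrime' (Δ : ℕ) : 2 ^ (2 * rootExp Δ) < classPrime' Δ := by
  refine lt_of_le_of_lt ?_ (lt_primeAbove _)
  have := Nat.pow_le_pow_right (n := 2) (by norm_num) (show 2 * rootExp Δ ≤ 3 * rootExp Δ by omega)
  omega

theorem two_mul_lt_classPrime_mul (Δ : ℕ) :
    2 * 50 * Δ < classPrime Δ * (2 ^ rootExp Δ + 1) := by
  have h : 100 * 2 ^ (3 * rootExp Δ) < classPrime Δ := lt_primeAbove _
  calc 2 * 50 * Δ ≤ 100 * 2 ^ (4 * rootExp Δ) := by have := le_two_pow_rootExp Δ; omega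
    _ = 100 * 2 ^ (3 * rootExp Δ) * 2 ^ rootExp Δ := by ring
    _ < classPrime Δ * (2 ^ rootExp Δ + 1) := Nat.mul_lt_mul'' h (Nat.lt_succ_self _)

theorem two_mul_lt_classPrime'_mul (Δ : ℕ) :
    2 * 50 * (planePrime Δ * (50 * 2 ^ rootExp Δ)) < classPrime' Δ * (0 + 1) := by
  have h : 10000 * 2 ^ (3 * rootExp Δ) < classPrime' Δ := lt_primeAbove _
  calc 2 * 50 * (planePrime Δ * (50 * 2 ^ rootExp Δ))
      ≤ 2 * 50 * (2 * 2 ^ (2 * rootExp Δ) * (50 * 2 ^ rootExp Δ)) :=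
        Nat.mul_le_mul_left _ (Nat.mul_le_mul_right _ (planePrime_le Δ))
    _ = 10000 * 2 ^ (3 * rootExp Δ) := by ring
    _ < classPrime' Δ * (0 + 1) := by omega

/-! ### The memory of a vertex and its update -/

/-- The memory of a vertex: whether a neighbor has a larger identifier, the colors after each step
of Linial's reduction, and the memories for the two stages. -/
abbrev Mem (n Δ : ℕ) : Type :=
  Bool × (∀ i : Fin (depth n Δ), Fin (2 ^ bitLen n Δ (i + 1))) ×
    Stage Δ (planePrime Δ) (classPrime Δ) × Stage Δ (planePrime Δ) (classPrime' Δ)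

/-- An arbitrary memory. -/
noncomputable def Mem.default (n Δ : ℕ) : Mem n Δ :=
  (false, fun _ => ⟨0, by positivity⟩, (⟨0, (primeAbove_prime _).pos⟩, none, none),
    (⟨0, (primeAbove_prime _).pos⟩, none, none))

section Update

variable {n Δ : ℕ} {ι : Type*} [Fintype ι]

/-- The color of a vertex, given by its identifier and its memory, after `i` steps of Linial's
reduction. -/
noncomputable def reducedColor (w : ℕ × Mem n Δ) : ℕ → ℕ
  | 0 => w.1
  | i + 1 => if h : i < depth n Δ then w.2.2.1 ⟨i, h⟩ else 0

/-- What the first stage knows of a vertex. The color is shifted by one to be nonzero. -/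
noncomputable def firstView (w : ℕ × Mem n Δ) : StageView Δ (planePrime Δ) (classPrime Δ) :=
  ⟨reducedColor w (depth n Δ) + 1, none, w.2.2.2.1⟩

/-- What the second stage knows of a vertex: here the colors of the first stage are fixed. -/
noncomputable def secondView (w : ℕ × Mem n Δ) : StageView Δ (planePrime Δ) (classPrime' Δ) :=
  ⟨reducedColor w (depth n Δ) + 1, w.2.2.2.1.2.2, w.2.2.2.2⟩

open Classical in
/-- The memory after one round, from the identifiers and memories of the vertex and its
neighbors. -/
noncomputable def nextMem (w : ℕ × Mem n Δ) (ν : ι → ℕ × Mem n Δ) : Mem n Δ :=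
  (decide (∃ p, w.1 < (ν p).1),
    fun i => Fin.ofNat _ (linialColor (linialPrime n Δ i) (bitLen n Δ i) (reducedColor w i)
      fun p => reducedColor (ν p) i),
    (firstView w).next 50 (2 ^ rootExp Δ) fun p => firstView (ν p),
    (secondView w).next 50 0 fun p => secondView (ν p))

/-- The color shown by a vertex. In a graph of maximum degree one, comparing identifiers suffices
(and is faster). -/
def shownColor (m : Mem n Δ) : ℕ :=
  if Δ ≤ 1 then min Δ m.1.toNat else m.2.2.2.2.2.elim 0 (fun y => (y : ℕ))

theorem shownColor_lt (m : Mem n Δ) : shownColor m < Δ + 1 := by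
  unfold shownColor
  split_ifs
  · omega
  · rcases m.2.2.2.2.2 with _ | y
    · simp
    · exact y.isLt

end Update

/-! ### Stabilization -/

section Stabilization

variable {V : Type*} {ι : V → Type*} [∀ v, Fintype (ι v)] {n Δ : ℕ} {nb : ∀ v, ι v → V}
  {ident : V → ℕ}

/-- One round on a graph given by the neighbors `nb v p` of the vertices `v`. -/
noncomputable def memRound (nb : ∀ v, ι v → V) (ident : V → ℕ) (c : V → Mem n Δ) (v : V) :
    Mem n Δ :=
  nextMem (ident v, c v) fun p => (ident (nb v p), c (nb v p))

theorem reducedColor_memRound {i : ℕ} (hi : i < depth n Δ) (c : V → Mem n Δ) (v : V) :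
    reducedColor (ident v, memRound nb ident c v) (i + 1) =
      linialColor (linialPrime n Δ i) (bitLen n Δ i) (reducedColor (ident v, c v) i)
        fun p => reducedColor (ident (nb v p), c (nb v p)) i := by
  simp only [reducedColor, hi, dite_true, memRound, nextMem, Fin.val_ofNat]
  refine Nat.mod_eq_of_lt (lt_of_lt_of_le (linialColor_lt ?_ _) (linialPrime_mul_self_le n Δ i))
  exact (primeAbove_prime _).pos

/-- After `i` rounds the first `i` colors of Linial's reduction are final. -/
theorem reducedColor_eq {σ : ℕ → V → Mem n Δ} {t₀ : ℕ}
    (hσ : ∀ t ≥ t₀, σ (t + 1) = memRound nb ident (σ t)) {i : ℕ} (hi : i ≤ depth n Δ) :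
    ∀ t ≥ t₀ + i, ∀ v,
      reducedColor (ident v, σ t v) i = reducedColor (ident v, σ (t₀ + i) v) i := by
  induction i with
  | zero => exact fun t _ v => rfl
  | succ i ih =>
    have ih := ih (by omega)
    have key : ∀ t ≥ t₀ + i, ∀ v, reducedColor (ident v, σ (t + 1) v) (i + 1) =
        linialColor (linialPrime n Δ i) (bitLen n Δ i) (reducedColor (ident v, σ (t₀ + i) v) i)
          fun p => reducedColor (ident (nb v p), σ (t₀ + i) (nb v p)) i := by
      intro t ht v
      rw [hσ t (by omega), reducedColor_memRound hi, ih t ht]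
      simp only [ih t ht]
    intro t ht v
    obtain ⟨t, rfl⟩ : ∃ t', t = t' + 1 := ⟨t - 1, by omega⟩
    rw [key t (by omega), ← add_assoc, key (t₀ + i) le_rfl]

/-- The final colors of every step of Linial's reduction are proper. -/
theorem reducedColor_proper {σ : ℕ → V → Mem n Δ} {t₀ : ℕ}
    (hσ : ∀ t ≥ t₀, σ (t + 1) = memRound nb ident (σ t)) (hcard : ∀ v, Fintype.card (ι v) ≤ Δ)
    (hlt : ∀ v, ident v < n) (hne : ∀ v p, ident (nb v p) ≠ ident v) {i : ℕ}
    (hi : i ≤ depth n Δ) :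
    ∀ t ≥ t₀ + i, ∀ v, reducedColor (ident v, σ t v) i < 2 ^ bitLen n Δ i ∧
      ∀ p, reducedColor (ident (nb v p), σ t (nb v p)) i ≠ reducedColor (ident v, σ t v) i := by
  induction i with
  | zero =>
    exact fun t _ v => ⟨(hlt v).trans_le (Nat.le_pow_clog (by norm_num) n), fun p => hne v p⟩
  | succ i ih =>
    intro t ht v
    obtain ⟨t, rfl⟩ : ∃ t', t = t' + 1 := ⟨t - 1, by omega⟩
    have ih := ih (by omega) t (by omega)
    have hq : (linialPrime n Δ i).Prime := primeAbove_prime _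
    have hpow : ∀ v, reducedColor (ident v, σ t v) i + 1 < linialPrime n Δ i ^ bitLen n Δ i := by
      intro v
      refine lt_of_le_of_lt (Nat.succ_le_of_lt (ih v).1)
        (Nat.pow_lt_pow_left (two_lt_linialPrime n Δ i) ?_)
      have := lt_bitLen_of_lt_depth (n := n) (Δ := Δ) (i := i) (by omega)
      omega
    rw [hσ t (by omega)]
    refine ⟨?_, fun p => ?_⟩
    · rw [reducedColor_memRound hi]
      exact (linialColor_lt hq.pos _).trans_le (linialPrime_mul_self_le n Δ i)
    · rw [reducedColor_memRound hi, reducedColor_memRound hi]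
      exact linialColor_ne hq (hpow v) (fun p => ⟨hpow _, (ih v).2 p⟩) (hcard v)
        (two_mul_bitLen_mul_lt_linialPrime n Δ i) p rfl

/-- The number of rounds after which the algorithm has stabilized, for maximum degree at least
two. -/
noncomputable def stabTime (n Δ : ℕ) : ℕ := depth n Δ + 3 * classPrime Δ + 3 * classPrime' Δ

theorem shownColor_proper {σ : ℕ → V → Mem n Δ} {t₀ : ℕ}
    (hσ : ∀ t ≥ t₀, σ (t + 1) = memRound nb ident (σ t)) (hcard : ∀ v, Fintype.card (ι v) ≤ Δ)
    (hsymm : ∀ v p, ∃ p', nb (nb v p) p' = v) (hlt : ∀ v, ident v < n)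
    (hne : ∀ v p, ident (nb v p) ≠ ident v) (hΔ : 2 ≤ Δ) {t : ℕ} (ht : t₀ + stabTime n Δ ≤ t)
    (v : V) (p : ι v) : shownColor (σ t (nb v p)) ≠ shownColor (σ t v) := by
  classical
  let big : V → ℕ := fun v => reducedColor (ident v, σ (t₀ + depth n Δ) v) (depth n Δ) + 1
  have hbig : ∀ t ≥ t₀ + depth n Δ, ∀ v, reducedColor (ident v, σ t v) (depth n Δ) + 1 = big v :=
    fun t ht v => by rw [reducedColor_eq hσ le_rfl t ht]
  have hprop := reducedColor_proper hσ hcard hlt hne le_rfl (t₀ + depth n Δ) le_rfl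
  -- the first stage
  have hσ₁ : ∀ t ≥ t₀ + depth n Δ, (fun v => (σ (t + 1) v).2.2.1) =
      stageRound nb 50 (2 ^ rootExp Δ) big (fun _ => none) fun v => (σ t v).2.2.1 := by
    intro t ht
    funext v
    rw [hσ t (by omega)]
    simp only [memRound, nextMem, stageRound, firstView, hbig t ht]
  have hfix₁ := stage_stabilizes (σ := fun t v => (σ t v).2.2.1) hσ₁
  set t₁ := t₀ + depth n Δ + 3 * classPrime Δ with ht₁
  have hs₁ := (hfix₁ (t₁ + 1) (by omega)).symm.trans (hσ₁ t₁ (by omega))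
  have hI₁ : StageInput nb 50 Δ (planePrime Δ) (classPrime Δ) big
      (fun _ => (none : Option (Fin (Δ + 1)))) :=
    { symm := hsymm
      card_le := hcard
      big_ne_zero := fun v => Nat.succ_ne_zero _
      big_lt := fun v => lt_pow_fifty (two_pow_lt_classPrime Δ) (hprop v).1
      big_lt' := fun v => lt_pow_fifty (two_pow_lt_planePrime Δ) (hprop v).1
      big_proper := fun v p h => (hprop v).2 p (Nat.succ_injective h)
      fixed_proper := by simp
      free_le := fun v _ s _ => (card_le_univ s).trans (hcard v) }
  have hq₀ : (planePrime Δ).Prime := primeAbove_prime _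
  -- the second stage
  have hσ₂ : ∀ t ≥ t₁, (fun v => (σ (t + 1) v).2.2.2) =
      stageRound nb 50 0 big (fun v => (σ t₁ v).2.2.1.2.2) fun v => (σ t v).2.2.2 := by
    intro t ht
    funext v
    have h : ∀ v, (σ t v).2.2.1 = (σ t₁ v).2.2.1 := fun v => congrFun (hfix₁ t ht) v
    rw [hσ t (by omega)]
    simp only [memRound, nextMem, stageRound, secondView, hbig t (by omega), h]
  have hfix₂ := stage_stabilizes (σ := fun t v => (σ t v).2.2.2) hσ₂
  set t₂ := t₁ + 3 * classPrime' Δ with ht₂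
  have hs₂ := (hfix₂ (t₂ + 1) (by omega)).symm.trans (hσ₂ t₂ (by omega))
  have hI₂ : StageInput nb 50 (planePrime Δ * (50 * 2 ^ rootExp Δ)) (planePrime Δ) (classPrime' Δ)
      big (fun v => (σ t₁ v).2.2.1.2.2) :=
    { symm := hsymm
      card_le := hcard
      big_ne_zero := fun v => Nat.succ_ne_zero _
      big_lt := fun v => lt_pow_fifty (two_pow_lt_classPrime' Δ) (hprop v).1
      big_lt' := hI₁.big_lt'
      big_proper := hI₁.big_proper
      fixed_proper := stage_proper hI₁ hs₁
      free_le := fun v hv s hs => by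
        refine le_trans (card_le_card fun p hp => ?_) (stage_free_lt (primeAbove_prime _) hq₀
          (lt_planePrime_mul_self Δ) (two_mul_lt_classPrime_mul Δ) hI₁ hs₁ hv).le
        exact mem_filter.2 ⟨mem_univ p, hs p hp⟩ }
  have hsome : ∀ v, ∃ y, (σ t₂ v).2.2.2.2.2 = some y := by
    intro v
    refine Option.ne_none_iff_exists'.1 fun hv => ?_
    have := stage_free_lt (primeAbove_prime _) hq₀ (lt_planePrime_mul_self Δ)
      (two_mul_lt_classPrime'_mul Δ) hI₂ hs₂ hv
    simp at this
  have heq : ∀ v, (σ t v).2.2.2 = (σ t₂ v).2.2.2 := fun v => congrFun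
    (hfix₂ t (by unfold stabTime at ht; omega)) v
  obtain ⟨y, hy⟩ := hsome v
  obtain ⟨z, hz⟩ := hsome (nb v p)
  have hyz := stage_proper hI₂ hs₂ v p y hy
  simp only [hz] at hyz
  simp only [shownColor, heq, hy, hz, if_neg (show ¬ Δ ≤ 1 by omega), Option.elim_some]
  exact fun h => hyz (congrArg some (Fin.ext h))

end Stabilization

/-! ### Messages -/

/-- The bit string for an identifier and a memory. -/
noncomputable def encode {n Δ : ℕ} (w : ℕ × Mem n Δ) : List Bool :=
  (w.1 * Fintype.card (Mem n Δ) + Fintype.equivFin (Mem n Δ) w.2).bits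

theorem encode_injective (n Δ : ℕ) : Function.Injective (encode (n := n) (Δ := Δ)) := by
  intro w w' h
  have h := congrArg (List.map fun b => cond b 1 0) h
  simp only [encode, ← Nat.digits_two_eq_bits, Nat.digits_inj_iff] at h
  have hlt := (Fintype.equivFin (Mem n Δ) w.2).isLt
  have hlt' := (Fintype.equivFin (Mem n Δ) w'.2).isLt
  have h1 : w.1 = w'.1 := by
    have hpos : 0 < Fintype.card (Mem n Δ) := by omega
    have := congrArg (· / Fintype.card (Mem n Δ)) h
    rwa [add_comm, Nat.add_mul_div_right _ _ hpos, Nat.div_eq_of_lt hlt, zero_add, add_comm,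
      Nat.add_mul_div_right _ _ hpos, Nat.div_eq_of_lt hlt', zero_add] at this
  rw [h1, Nat.add_left_cancel_iff] at h
  exact Prod.ext h1 ((Fintype.equivFin _).injective (Fin.ext h))

/-- The identifier and the memory encoded by a bit string. -/
noncomputable def decode {n Δ : ℕ} : List Bool → ℕ × Mem n Δ :=
  haveI : Nonempty (ℕ × Mem n Δ) := ⟨(0, Mem.default n Δ)⟩
  Function.invFun encode

theorem decode_encode {n Δ : ℕ} (w : ℕ × Mem n Δ) : decode (encode w) = w :=
  haveI : Nonempty (ℕ × Mem n Δ) := ⟨w⟩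
  Function.leftInverse_invFun (encode_injective n Δ) w

theorem card_mem_le {n Δ : ℕ} (hn : 2 ≤ n) (hΔ : Δ ≤ n) :
    Fintype.card (Mem n Δ) ≤ 2 ^ (69 * Nat.clog 2 n) := by
  have hl : 1 ≤ Nat.clog 2 n := Nat.clog_pos (by norm_num) hn
  have hg : rootExp Δ ≤ 2 * Nat.clog 2 n := by
    have : Nat.clog 16 Δ ≤ Nat.clog 2 n := Nat.clog_le_of_le_pow <|
      (hΔ.trans (Nat.le_pow_clog (by norm_num) n)).trans (Nat.pow_le_pow_left (by norm_num) _)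
    unfold rootExp
    omega
  have h1 : ∀ k, 1 ≤ 2 ^ k := fun k => Nat.one_le_two_pow
  have hlin : ∏ i : Fin (depth n Δ), 2 ^ bitLen n Δ (i + 1) ≤ 2 ^ Nat.clog 2 n := by
    rw [prod_pow_eq_pow_sum, Fin.sum_univ_eq_sum_range (fun i => bitLen n Δ (i + 1))]
    exact Nat.pow_le_pow_right (by norm_num) (sum_bitLen_le n Δ)
  have h0 : planePrime Δ + 1 ≤ 2 ^ (2 + 2 * rootExp Δ) := by
    have := planePrime_le Δ
    have := h1 (2 * rootExp Δ)
    rw [pow_add]; omega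
  have hc : classPrime Δ ≤ 2 ^ (8 + 3 * rootExp Δ) := by
    have := classPrime_le Δ
    rw [pow_add]; omega
  have hc' : classPrime' Δ ≤ 2 ^ (15 + 3 * rootExp Δ) := by
    have := classPrime'_le Δ
    rw [pow_add]; omega
  have hd : Δ + 1 + 1 ≤ 2 ^ (2 + 4 * rootExp Δ) := by
    have := le_two_pow_rootExp Δ
    have := h1 (4 * rootExp Δ)
    rw [pow_add]; omega
  have hcard : Fintype.card (Mem n Δ) = 2 * ((∏ i : Fin (depth n Δ), 2 ^ bitLen n Δ (i + 1)) *
      ((classPrime Δ * ((planePrime Δ + 1) * (Δ + 1 + 1))) *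
        (classPrime' Δ * ((planePrime Δ + 1) * (Δ + 1 + 1))))) := by
    simp [Fintype.card_prod, Fintype.card_pi, Fintype.card_option]
  rw [hcard]
  calc _ ≤ 2 * (2 ^ Nat.clog 2 n *
      ((2 ^ (8 + 3 * rootExp Δ) * (2 ^ (2 + 2 * rootExp Δ) * 2 ^ (2 + 4 * rootExp Δ))) *
        (2 ^ (15 + 3 * rootExp Δ) * (2 ^ (2 + 2 * rootExp Δ) * 2 ^ (2 + 4 * rootExp Δ))))) := by
        gcongr
    _ = 2 ^ (1 + Nat.clog 2 n + 31 + 18 * rootExp Δ) := by ring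
    _ ≤ _ := Nat.pow_le_pow_right (by norm_num) (by omega)

theorem length_encode_le {n Δ : ℕ} (hn : 2 ≤ n) (hΔ : Δ ≤ n) (w : ℕ × Mem n Δ) (hw : w.1 < n) :
    ((encode w).length : ℝ) ≤ 140 * Real.logb 2 n := by
  have hlt := (Fintype.equivFin (Mem n Δ) w.2).isLt
  have h1 : (encode w).length ≤ 70 * Nat.clog 2 n := by
    rw [encode, Nat.size_eq_bits_len, Nat.size_le]
    calc _ < (w.1 + 1) * Fintype.card (Mem n Δ) := by rw [add_mul, one_mul]; omega
      _ ≤ 2 ^ Nat.clog 2 n * 2 ^ (69 * Nat.clog 2 n) :=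
        Nat.mul_le_mul (hw.trans_le (Nat.le_pow_clog (by norm_num) n)) (card_mem_le hn hΔ)
      _ = _ := by ring
  have h2 := clog_two_le_logb hn
  have h3 : 1 ≤ Real.logb 2 n := by
    rw [Real.le_logb_iff_rpow_le (by norm_num) (by positivity), Real.rpow_one]
    exact_mod_cast hn
  have h4 : ((encode w).length : ℝ) ≤ 70 * Nat.clog 2 n := by exact_mod_cast h1
  linarith

/-! ### The algorithm -/

/-- In each round every vertex sends its identifier and its memory to all neighbors. -/
noncomputable def coloringAlgorithm : Algorithm where
  Ram r := Mem r.numVertices r.maxDegree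
  finite_ram _ := inferInstance
  init r := Mem.default r.numVertices r.maxDegree
  send r m _ := encode (r.ident, m)
  update r m μ := nextMem (r.ident, m) fun p => decode (μ p)
  color _ m := shownColor m

section Network

variable {V : Type*} [Fintype V] (N : Network V)

theorem Network.ports_le (v : V) : (N.rom v).ports ≤ N.maxDegree := by
  classical
  change (N.graph.neighborSet v).ncard ≤ _
  rw [← Nat.card_coe_set_eq, Nat.card_eq_fintype_card, SimpleGraph.card_neighborSet_eq_degree]
  unfold Network.maxDegree
  convert N.graph.degree_le_maxDegree v

theorem Network.maxDegree_le_card : N.maxDegree ≤ Fintype.card V := by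
  classical
  unfold Network.maxDegree
  exact SimpleGraph.maxDegree_le_of_forall_degree_le _ _ fun v =>
    (N.graph.degree_lt_card_verts v).le

theorem Network.exists_neighbor {u v : V} (h : N.graph.Adj u v) : ∃ p, N.neighbor u p = v :=
  ⟨(N.port u).symm ⟨v, h⟩, by simp [Network.neighbor]⟩

theorem Network.adj_neighbor (v : V) (p : Fin (N.rom v).ports) :
    N.graph.Adj v (N.neighbor v p) := (N.port v p).2

theorem Network.neighbor_symm (v : V) (p : Fin (N.rom v).ports) :
    ∃ p', N.neighbor (N.neighbor v p) p' = v := N.exists_neighbor (N.adj_neighbor v p).symm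

theorem Network.ident_neighbor_ne (v : V) (p : Fin (N.rom v).ports) :
    (N.ident (N.neighbor v p) : ℕ) ≠ N.ident v :=
  fun h => (N.adj_neighbor v p).ne' (N.ident.injective (Fin.ext h))

theorem coloringAlgorithm_step (c : coloringAlgorithm.Config N) :
    coloringAlgorithm.step N c =
      memRound (n := Fintype.card V) (Δ := N.maxDegree) N.neighbor (fun v => N.ident v) c := by
  funext v
  exact congrArg (nextMem _) (funext fun p => decode_encode _)

/-- In a graph of maximum degree one, a single comparison of identifiers is enough. -/
theorem shownColor_memRound_ne (h1 : N.maxDegree = 1)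
    (c : V → Mem (Fintype.card V) N.maxDegree) {u v : V} (h : N.graph.Adj u v) :
    shownColor (memRound N.neighbor (fun v => N.ident v) c u) ≠
      shownColor (memRound N.neighbor (fun v => N.ident v) c v) := by
  have side : ∀ {u v : V}, N.graph.Adj u v →
      ((memRound N.neighbor (fun v => (N.ident v : ℕ)) c u).1 = true ↔ N.ident u < N.ident v) := by
    intro u v h
    simp only [memRound, nextMem, decide_eq_true_eq]
    obtain ⟨p, rfl⟩ := N.exists_neighbor h
    refine ⟨fun ⟨p', hp'⟩ => ?_, fun h => ⟨p, h⟩⟩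
    have hle := N.ports_le u
    have := p.isLt
    have := p'.isLt
    rwa [show p' = p from Fin.ext (by omega)] at hp'
  have hu := side h
  have hv := side h.symm
  have hne : N.ident u ≠ N.ident v := fun e => h.ne (N.ident.injective e)
  unfold shownColor
  rw [if_pos h1.le, if_pos h1.le]
  rcases lt_or_gt_of_ne hne with hlt | hlt
  · rw [hu.2 hlt, Bool.eq_false_iff.2 (fun e => (hv.1 e).not_gt hlt), h1]
    simp
  · rw [hv.2 hlt, Bool.eq_false_iff.2 (fun e => (hu.1 e).not_gt hlt), h1]
    simp

end Network

theorem stabTime_le {n Δ : ℕ} (hΔ : 2 ≤ Δ) :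
    (stabTime n Δ : ℝ) ≤ 3878400 * ((Δ : ℝ) ^ (3 / 4 : ℝ) * Real.logb 2 Δ) + logStar n := by
  have h1 : stabTime n Δ ≤ logStar n + 60600 * 2 ^ (3 * rootExp Δ) := by
    have := depth_le_logStar n Δ
    have := classPrime_le Δ
    have := classPrime'_le Δ
    unfold stabTime
    omega
  have h2 : ((2 : ℝ) ^ (3 * rootExp Δ)) ≤ 64 * (Δ : ℝ) ^ (3 / 4 : ℝ) := by
    have h3 : ((2 : ℝ) ^ (4 * rootExp Δ)) ≤ 256 * Δ := by exact_mod_cast two_pow_rootExp_le hΔ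
    calc ((2 : ℝ) ^ (3 * rootExp Δ)) = ((2 : ℝ) ^ (4 * rootExp Δ)) ^ (3 / 4 : ℝ) := by
          rw [← Real.rpow_natCast, ← Real.rpow_natCast, ← Real.rpow_mul (by norm_num)]
          push_cast
          ring_nf
      _ ≤ (256 * Δ) ^ (3 / 4 : ℝ) := Real.rpow_le_rpow (by positivity) h3 (by norm_num)
      _ = 64 * (Δ : ℝ) ^ (3 / 4 : ℝ) := by
          rw [Real.mul_rpow (by norm_num) (by positivity), show (256 : ℝ) = 4 ^ (4 : ℝ) by norm_num,
            ← Real.rpow_mul (by norm_num)]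
          norm_num
  have h3 : 1 ≤ Real.logb 2 Δ := by
    rw [Real.le_logb_iff_rpow_le (by norm_num) (by positivity), Real.rpow_one]
    exact_mod_cast hΔ
  have h4 : (stabTime n Δ : ℝ) ≤ logStar n + 60600 * 2 ^ (3 * rootExp Δ) := by exact_mod_cast h1
  have h5 : (Δ : ℝ) ^ (3 / 4 : ℝ) ≤ (Δ : ℝ) ^ (3 / 4 : ℝ) * Real.logb 2 Δ :=
    le_mul_of_one_le_right (by positivity) h3
  linarith

theorem theorem2 :
    ∃ (A : Algorithm) (C₁ C₂ : ℝ), ∀ (V : Type*) [Fintype V] (N : Network V),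
      (∃ T : ℕ,
        (T : ℝ) ≤ C₁ * ((N.maxDegree : ℝ) ^ (3 / 4 : ℝ) * Real.logb 2 N.maxDegree)
          + logStar (Fintype.card V) ∧
        A.StabilizesWithin N T) ∧
      A.MessageBitsAtMost N (C₂ * Real.logb 2 (Fintype.card V)) := by
  refine ⟨coloringAlgorithm, 3878400, 140, fun V _ N => ⟨?_, ?_⟩⟩
  · rcases (show N.maxDegree = 0 ∨ N.maxDegree = 1 ∨ 2 ≤ N.maxDegree by omega) with h | h | h
    · refine ⟨0, by simp [h], fun F σ _ T₀ _ t _ => ⟨fun v => shownColor_lt _, fun u v huv => ?_⟩⟩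
      obtain ⟨p, -⟩ := N.exists_neighbor huv
      have := p.isLt
      have := N.ports_le u
      omega
    · refine ⟨1, ?_, fun F σ hσ T₀ hF t ht => ⟨fun v => shownColor_lt _, fun u v huv => ?_⟩⟩
      · have hn : 1 < Fintype.card V := by
          by_contra! hle
          classical
          have : N.maxDegree ≤ 0 := by
            unfold Network.maxDegree
            refine SimpleGraph.maxDegree_le_of_forall_degree_le _ _ fun v => ?_
            have := N.graph.degree_lt_card_verts v
            omega
          omega
        have : 0 < logStar (Fintype.card V : ℝ) := lt_logStar fun j hj => by
          obtain rfl : j = 0 := by omega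
          simpa using hn
        have : (1 : ℝ) ≤ logStar (Fintype.card V : ℝ) := by exact_mod_cast this
        simpa [h] using this
      · obtain ⟨t, rfl⟩ : ∃ t', t = t' + 1 := ⟨t - 1, by omega⟩
        rw [hσ.2 t (fun hmem => by have := hF _ hmem; omega), coloringAlgorithm_step]
        exact shownColor_memRound_ne N h _ huv
    · refine ⟨stabTime (Fintype.card V) N.maxDegree, stabTime_le h,
        fun F σ hσ T₀ hF t ht => ⟨fun v => shownColor_lt _, fun u v huv => ?_⟩⟩
      obtain ⟨p, rfl⟩ := N.exists_neighbor huv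
      have hrun : ∀ t ≥ T₀, σ (t + 1) = memRound (n := Fintype.card V) (Δ := N.maxDegree)
          N.neighbor (fun v => N.ident v) (σ t) := fun t ht => by
        rw [hσ.2 t (fun hmem => by have := hF _ hmem; omega), coloringAlgorithm_step]
      exact (shownColor_proper hrun (fun v => by rw [Fintype.card_fin]; exact N.ports_le v)
        N.neighbor_symm (fun v => (N.ident v).isLt) N.ident_neighbor_ne h ht u p).symm
  · intro c v p
    have hn : 2 ≤ Fintype.card V := by
      have hadj := N.adj_neighbor v p
      exact Fintype.one_lt_card_iff.2 ⟨_, _, hadj.ne⟩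
    exact length_encode_le hn N.maxDegree_le_card _ (N.ident v).isLt
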